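/- **Setting.** Consider a feed-forward network whose graph is a directed acyclic graph given in layered form with possible skip connections: layer $0$ carries the input $x$, layers $1,\dots,L-1$ are hidden, layer $L$ has $d_y\ge 2$ output units (one per class), and, with weights supported on the edges, the pre-activations are $z^{[l]}(x,w)=\sum_{l'<l}W^{(l,l')}\sigma^{[l']}(z^{[l']}(x,w))$ with $\sigma^{[0]}(z^{[0]})=x$. The nonlinearity is ReLU and/or max pooling, written $\sigma^{[l]}(z)=\dot\sigma^{[l]}\circ z$ with activations in $\{0,1\}$: unit $j$ is active iff it attains the maximum of its pooling region (the first such unit in case of ties) and, where ReLU is applied, $z_j>0$. For a path $j$ from the input to the output layer (identified with its input and hidden units), let $\bar x_j$ be the input coordinate at which it starts, $\bar\sigma_j(x,w)\in\{0,1\}$ the product of the activations of its hidden units, and $[\bar x\circ\bar\sigma(x,w)]_j=\bar x_j\bar\sigma_j(x,w)$. For frozen parameters $w_\sigma$, a two-phase model is $f=(f_1,\dots,f_{d_y})$ with $f_k(x)=[\bar x\circ\bar\sigma(x,w_\sigma)]^\top\bar w_k$, where $\bar w_1,\dots,\bar w_{d_y}$ are vectors of path weights. Let $\mathcal F=\mathcal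 F(w_\sigma)$ be the set of all two-phase models with frozen $w_\sigma$ and $\max_k\|\bar w_k\|_2\le C_w$. Let $\mathcal R[f]$ be the expected 0–1 loss under $\mathbb P_{(X,Y)}$ of classification by the largest score, a tie $f_y(x)=\max_{y'\ne y}f_{y'}(x)$ being counted as an error. For $\rho>0$ put $\ell_\rho(t)=0$ if $t\ge\rho$, $\ell_\rho(t)=1-t/\rho$ if $0\le t\le\rho$, $\ell_\rho(t)=1$ if $t\le 0$, and for a data set $T$ let $\mathcal R_T^{(\rho)}[f]=\frac1{|T|}\sum_{(x,y)\in T}\ell_\rho\big(f_y(x)-\max_{y'\neq y}f_{y'}(x)\big)$. **Theorem.** Let $m\ge1$ and $\alpha\in(0,1)$ with $\alpha m\in\mathbb N$, put $m_\sigma=(1-\alpha)m$, let $S=((x_1,y_1),\dots,(x_m,y_m))$ be a random sample, and let $S_{\alpha m}$ consist of its first $\alpha m$ examples. Assume that $S\setminus S_{\alpha m}$ is drawn i.i.d. from $\mathbb P_{(X,Y)}$ and is independent of $S_{\alpha m}$. Let $\rho>0$, $\delta>0$, $C_\sigma\ge0$ and $C_w$ be real. Then for every fixed $w_\sigma$ with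 $\mathbb E_x\big[\|\bar x\circ\bar\sigma(x,w_\sigma)\|_2^2\big]\le C_\sigma^2$ (the expectation being finite), with probability at least $1-\delta$, the following holds for all $f\in\mathcal F(w_\sigma)$: $$ \mathcal R[f]\le\mathcal R^{(\rho)}_{S\setminus S_{\alpha m}}[f]+\frac{2d_y^2(1-\alpha)^{-1/2}C_\sigma C_w}{\rho\sqrt{m_\sigma}}+\sqrt{\frac{\ln(1/\delta)}{2m_\sigma}} , $$ where for $\delta>1$, when the probability claim is vacuous, the last term is read as $0$. Moreover, for almost every value of $S_{\alpha m}$, the same holds with conditional probability at least $1-\delta$ given $S_{\alpha m}$, simultaneously for all such $w_\sigma$; so $w_\sigma$ may be any value learned from $S_{\alpha m}$. -/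

import Mathlib

open MeasureTheory ProbabilityTheory
open scoped InnerProductSpace

noncomputable section

/-- The architecture of a feed-forward network with the structure of a directed acyclic graph,
given in layered form with possible skip connections. Layer `0` is the input, layers
`1, …, hidden` are the hidden layers and layer `L = hidden + 1` is the output. -/
structure DeepNet where
  /-- the number `L - 1` of hidden layers -/
  hidden : ℕ
  /-- the number of units of each layer -/
  width : ℕ → ℕ
  /-- `conn l l' j j'`: there is an edge from unit `j'` of layer `l'` to unit `j` of layer `l`
  (used only for `l' < l`) -/
  conn : (l l' : ℕ) → Fin (width l) → Fin (width l') → Prop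
  /-- max pooling: the units of layer `l` that carry the same label form one pooling region
  (pairwise different labels: no pooling) -/
  pool : (l : ℕ) → Fin (width l) → ℕ
  /-- the units to which ReLU is applied -/
  relu : (l : ℕ) → Fin (width l) → Prop

namespace DeepNet

variable (N : DeepNet)

/-- The index `L` of the output layer. -/
abbrev depth : ℕ := N.hidden + 1

/-- Inputs `x`. -/
abbrev Input : Type := Fin (N.width 0) → ℝ

/-- Class labels `y ∈ {1, …, d_y}`; there is one output unit for each of them. -/
abbrev Label : Type := Fin (N.width N.depth)

/-- Labelled examples `(x, y)`. -/
abbrev Example : Type := N.Input × N.Label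

/-- The weight matrices `W^{(l, l')}`; only the entries on edges are used. -/
abbrev Weights : Type := (l l' : ℕ) → Matrix (Fin (N.width l)) (Fin (N.width l')) ℝ

open Classical in
/-- The 0-1 activation of unit `j` of layer `l` at the pre-activation vector `z` of that layer:
the unit is active if it attains the maximum of its pooling region (the first unit that does so,
in case of ties) and, where ReLU is applied, its pre-activation is positive.
Input units are always active. -/
def gate (l : ℕ) (z : Fin (N.width l) → ℝ) (j : Fin (N.width l)) : ℝ :=
  if l = 0 ∨
      ((∀ j', N.pool l j' = N.pool l j → z j' < z j ∨ (z j' = z j ∧ j ≤ j')) ∧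
        (N.relu l j → 0 < z j))
  then 1 else 0

/-- The nonlinearity of layer `l`: the entrywise product of the activations with `z`. -/
def nonlin (l : ℕ) (z : Fin (N.width l) → ℝ) (j : Fin (N.width l)) : ℝ :=
  N.gate l z j * z j

open Classical in
/-- The pre-activation vectors: layer `0` carries the input, and
`z^{[l]} = ∑_{l' < l} W^{(l, l')} σ^{[l']}(z^{[l']})` along the edges. -/
def preact (w : N.Weights) (x : N.Input) : (l : ℕ) → Fin (N.width l) → ℝ
  | 0 => x
  | l + 1 => fun j => ∑ l' : Fin (l + 1), ∑ j' : Fin (N.width l'),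
      if N.conn (l + 1) l' j j' then
        w (l + 1) l' j j' * N.nonlin l' (preact w x l') j'
      else 0
termination_by l => l
decreasing_by exact l'.isLt

/-- Directed walks along edges from an input unit to unit `j` of layer `l`. -/
inductive Route : (l : ℕ) → Fin (N.width l) → Type
  | input (i : Fin (N.width 0)) : Route 0 i
  | step {l' l : ℕ} {j' : Fin (N.width l')} {j : Fin (N.width l)} (hlt : l' < l)
      (hconn : N.conn l l' j j') (r : Route l' j') : Route l j

instance finite_route (l : ℕ) (j : Fin (N.width l)) : Finite (N.Route l j) := by
  induction l using Nat.strong_induction_on with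
  | _ l ih =>
    have inst : ∀ (l' : Fin l) (j' : Fin (N.width l')), Finite (N.Route l' j') :=
      fun l' j' => ih l' l'.isLt j'
    let code : N.Route l j →
        Option (Σ l' : Fin l, Σ j' : Fin (N.width l'), N.Route l' j') := fun r =>
      match r with
      | .input _ => none
      | .step (l' := l') (j' := j') hlt _ r' => some ⟨⟨l', hlt⟩, j', r'⟩
    refine Finite.of_injective code ?_
    intro r s h
    cases r with
    | input i =>
      cases s with
      | input _ => rfl
      | step hlt _ _ => exact absurd hlt (Nat.not_lt_zero _)
    | step hlt hc r' =>
      cases s with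
      | input _ => exact absurd hlt (Nat.not_lt_zero _)
      | step hlt2 hc2 s' =>
        simp only [code, Option.some.injEq, Sigma.mk.injEq, Fin.mk.injEq] at h
        obtain ⟨h1, h2⟩ := h
        subst h1
        simp only [heq_eq_eq, Sigma.mk.injEq] at h2
        obtain ⟨h3, h4⟩ := h2
        subst h3
        simp only [heq_eq_eq] at h4
        subst h4
        rfl

/-- The input unit at which a walk starts. -/
def Route.source {N : DeepNet} : {l : ℕ} → {j : Fin (N.width l)} → N.Route l j → Fin (N.width 0)
  | _, _, .input i => i
  | _, _, .step _ _ r => r.source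

/-- The product of the 0-1 activations of the units on a walk. -/
def Route.activation {N : DeepNet} (w : N.Weights) (x : N.Input) :
    {l : ℕ} → {j : Fin (N.width l)} → N.Route l j → ℝ
  | _, _, .input _ => 1
  | _, _, .step (l := l) (j := j) _ _ r => r.activation w x * N.gate l (N.preact w x l) j

/-- The paths from the input to the output layer, indexed independently of the output unit:
walks to an input or hidden unit that has an edge to some output unit. -/
abbrev Path : Type :=
  Σ l : Fin N.depth,
    Σ j : {j : Fin (N.width l) // ∃ k, N.conn N.depth l k j}, N.Route l j.1

instance fintypePath : Fintype N.Path := Fintype.ofFinite _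

/-- The vector `x̄ ∘ σ̄(x, w)`, indexed by the paths. -/
def pathFeature (w : N.Weights) (x : N.Input) : EuclideanSpace ℝ N.Path :=
  WithLp.toLp 2 fun p => x p.2.2.source * p.2.2.activation w x

/-- The two-phase model with frozen parameters `wσ` in the activations and path weights `wbar k`
for each output unit `k`: `x ↦ ([x̄ ∘ σ̄(x, wσ)]ᵀ wbar k)ₖ`. -/
def twoPhaseModel (wσ : N.Weights) (wbar : N.Label → EuclideanSpace ℝ N.Path)
    (x : N.Input) (k : N.Label) : ℝ :=
  ⟪N.pathFeature wσ x, wbar k⟫_ℝ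

/-- All two-phase models with frozen `wσ` whose path weights satisfy `max_k ‖wbar k‖₂ ≤ Cw`. -/
def twoPhaseClass (wσ : N.Weights) (Cw : ℝ) : Set (N.Input → N.Label → ℝ) :=
  {f | ∃ wbar : N.Label → EuclideanSpace ℝ N.Path,
    (∀ k, ‖wbar k‖ ≤ Cw) ∧ f = N.twoPhaseModel wσ wbar}

end DeepNet

open Classical in
/-- 0-1 loss of the score vector `z` at the label `y`; a tie for the largest score counts as an
error, so this dominates the 0-1 loss of every rule that predicts a label of largest score. -/
def zeroOneLoss {d : ℕ} (z : Fin d → ℝ) (y : Fin d) : ℝ :=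
  if ∃ k, k ≠ y ∧ z y ≤ z k then 1 else 0

/-- Expected 0-1 loss under the distribution `P` of `(x, y)`. -/
def zeroOneRisk {X : Type*} [MeasurableSpace X] {d : ℕ} (P : Measure (X × Fin d))
    (f : X → Fin d → ℝ) : ℝ :=
  ∫ p, zeroOneLoss (f p.1) p.2 ∂P

/-- The multi-class margin `z_y - max_{y' ≠ y} z_{y'}` (at least two classes). -/
def classMargin {d : ℕ} (z : Fin d → ℝ) (y : Fin d) : ℝ :=
  z y - ⨆ k : {k : Fin d // k ≠ y}, z k

/-- The ramp function with parameter `ρ`. -/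
def rampLoss (ρ t : ℝ) : ℝ :=
  if ρ ≤ t then 0 else if 0 ≤ t then 1 - t / ρ else 1

/-- The empirical `ρ`-margin loss of `f` on the data set `t`. -/
def empiricalMarginLoss {X ι : Type*} [Fintype ι] {d : ℕ} (ρ : ℝ) (t : ι → X × Fin d)
    (f : X → Fin d → ℝ) : ℝ :=
  (1 / (Fintype.card ι : ℝ)) * ∑ i, rampLoss ρ (classMargin (f (t i).1) (t i).2)

/-- The first `a` examples of a sample of size `m`. -/
def headSample {Ω Z : Type*} {m : ℕ} (a : ℕ) (S : Fin m → Ω → Z) (ω : Ω) :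
    {i : Fin m // (i : ℕ) < a} → Z :=
  fun i => S i ω

/-- The remaining `m - a` examples. -/
def tailSample {Ω Z : Type*} {m : ℕ} (a : ℕ) (S : Fin m → Ω → Z) (ω : Ω) :
    {i : Fin m // a ≤ (i : ℕ)} → Z :=
  fun i => S i ω

end

/-! Once `wσ` is frozen, a two-phase model is linear in its path weights with a fixed feature map,
so this is a margin bound for a multi-class linear classifier on examples that are independent of
how `wσ` was found.

The ramp loss of the margin dominates the 0-1 loss and is `1/ρ`-Lipschitz for the `ℓ¹` distance of
score vectors. McDiarmid's inequality reduces the uniform deviation between expected and empirical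
ramp loss to its mean, at the cost of the logarithmic term.

The mean is bounded in `integral_ciSup_deviation_le` without explicit Rademacher variables. One
example at a time, its loss is symmetrized (`integral_ciSup_add_integral_sub_le`) and then exchanged
for plus or minus a multiple of one linear score, averaged over the labels
(`ciSup_add_ciSup_le_sum`). The scores accumulate in a vector `x`; since both signs occur, the
parallelogram law makes `‖x‖ ^ 2` grow additively, by at most `(2 * L * d * σ) ^ 2` per example on
average, with `d` the number of labels. Hence a mean of order `√n`.

All this is done for finite classes, where suprema are attained. A dense sequence of path weights
and continuity of the loss extend it to the whole class. The good event concerns the held-out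
examples only, whose conditional law given the head is almost surely their own law. -/

section Product

/-! ### McDiarmid's inequality for i.i.d. samples. -/

variable {Z : Type*} [MeasurableSpace Z] (P : Measure Z) [IsProbabilityMeasure P]

lemma measurePreserving_finCons (n : ℕ) :
    MeasurePreserving (fun p : Z × (Fin n → Z) => (Fin.cons p.1 p.2 : Fin (n + 1) → Z))
      (P.prod (Measure.pi fun _ => P)) (Measure.pi fun _ => P) := by
  have h := (measurePreserving_piFinSuccAbove (fun _ : Fin (n + 1) => P) 0).symm
  convert h using 1
  ext p i
  simp [MeasurableEquiv.piFinSuccAbove, Fin.insertNthEquiv]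

lemma integral_finCons {n : ℕ} (F : (Fin (n + 1) → Z) → ℝ) (hF : Measurable F) {C : ℝ}
    (hC : ∀ t, |F t| ≤ C) :
    ∫ t, F t ∂(Measure.pi fun _ => P)
      = ∫ t : Fin n → Z, ∫ z, F (Fin.cons z t) ∂P ∂(Measure.pi fun _ => P) := by
  have hm := measurePreserving_finCons P n
  rw [← hm.map_eq, integral_map hm.measurable.aemeasurable hF.aestronglyMeasurable]
  refine integral_prod_symm (fun p : Z × (Fin n → Z) => F (Fin.cons p.1 p.2)) ?_
  exact Integrable.of_bound (hF.comp hm.measurable).aestronglyMeasurable C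
    (Filter.Eventually.of_forall fun p => hC _)

/-- Hoeffding's lemma for a function whose oscillation is at most `c`. -/
lemma integral_exp_sub_integral_le {g : Z → ℝ} (hg : Measurable g) {c : ℝ} (hc : 0 ≤ c)
    (hd : ∀ z z', g z - g z' ≤ c) (s : ℝ) :
    ∫ z, Real.exp (s * (g z - ∫ z, g z ∂P)) ∂P ≤ Real.exp (c ^ 2 / 4 * s ^ 2 / 2) := by
  have : Nonempty Z := P.nonempty_of_neZero
  have hbdd : BddBelow (Set.range g) := by
    refine ⟨g (Classical.arbitrary Z) - c, ?_⟩
    rintro _ ⟨z, rfl⟩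
    linarith [hd (Classical.arbitrary Z) z]
  have h := hasSubgaussianMGF_of_mem_Icc (μ := P) (X := g) (a := ⨅ z, g z) (b := (⨅ z, g z) + c)
    hg.aemeasurable (Filter.Eventually.of_forall fun z => ⟨ciInf_le hbdd z, by
      have : g z - c ≤ ⨅ z, g z := le_ciInf fun z' => by linarith [hd z z']
      linarith⟩)
  have h2 := h.mgf_le s
  refine h2.trans_eq ?_
  congr 1
  simp only [add_sub_cancel_left]
  push_cast
  rw [Real.norm_of_nonneg hc]
  ring

/-- McDiarmid's bound of the moment generating function. -/
lemma integral_exp_le_of_bounded_differences {n : ℕ} {F : (Fin n → Z) → ℝ} (hF : Measurable F)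
    {c C : ℝ} (hc : 0 ≤ c) (hC : ∀ t, |F t| ≤ C)
    (hd : ∀ t i z, F (Function.update t i z) - F t ≤ c) (s : ℝ) :
    ∫ t, Real.exp (s * (F t - ∫ t, F t ∂(Measure.pi fun _ => P))) ∂(Measure.pi fun _ => P)
      ≤ Real.exp (n * (c ^ 2 / 4) * s ^ 2 / 2) := by
  induction n generalizing C with
  | zero =>
    have : ∀ t, F t = F default := fun t => congrArg F (Subsingleton.elim _ _)
    simp [this]
  | succ n ih =>
    have hcons : Measurable fun p : Z × (Fin n → Z) => F (Fin.cons p.1 p.2) :=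
      hF.comp (measurePreserving_finCons P n).measurable
    have hz : ∀ t : Fin n → Z, Measurable fun z => F (Fin.cons z t) := fun t =>
      hcons.comp (measurable_id.prodMk measurable_const)
    have hi : ∀ t : Fin n → Z, Integrable (fun z => F (Fin.cons z t)) P := fun t =>
      Integrable.of_bound (hz t).aestronglyMeasurable C
        (Filter.Eventually.of_forall fun z => hC _)
    -- With the first coordinate integrated out, `F - E` splits into `F - G`, treated by Hoeffding's
    -- lemma with the other coordinates fixed, and `G - E`, treated by induction since `G` inherits
    -- the bounded differences.
    set G : (Fin n → Z) → ℝ := fun t => ∫ z, F (Fin.cons z t) ∂P with hG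
    have hGm : Measurable G :=
      (hcons.stronglyMeasurable.integral_prod_left (μ := P)).measurable
    have hGC : ∀ t, |G t| ≤ C := fun t => by
      have := norm_integral_le_of_norm_le_const (μ := P) (f := fun z => F (Fin.cons z t))
        (Filter.Eventually.of_forall fun z => hC (Fin.cons z t))
      simpa using this
    have hGd : ∀ t i z, G (Function.update t i z) - G t ≤ c := fun t i z => by
      rw [hG, ← integral_sub (hi _) (hi _)]
      have : ∀ y, F (Fin.cons y (Function.update t i z)) - F (Fin.cons y t) ≤ c := fun y => by
        rw [Fin.cons_update (α := fun _ => Z)]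
        exact hd _ _ _
      calc _ ≤ ∫ _, c ∂P := integral_mono ((hi _).sub (hi _)) (integrable_const _) this
        _ = c := by simp
    have hE : ∫ t, F t ∂(Measure.pi fun _ => P) = ∫ t, G t ∂(Measure.pi fun _ => P) :=
      integral_finCons P F hF hC
    set E := ∫ t, G t ∂(Measure.pi fun _ => P) with hEdef
    have hexpC : ∀ f y : ℝ, |f| ≤ C → |Real.exp (s * (f - y))| ≤ Real.exp (|s| * (C + |y|)) := by
      intro f y h
      rw [Real.abs_exp, Real.exp_le_exp]
      calc s * (f - y) ≤ |s| * |f - y| := by rw [← abs_mul]; exact le_abs_self _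
        _ ≤ _ := by gcongr; exact (abs_sub _ _).trans (by gcongr)
    rw [hE, integral_finCons P _ (by fun_prop) (fun t => hexpC _ E (hC t))]
    have key : ∀ t : Fin n → Z, ∫ z, Real.exp (s * (F (Fin.cons z t) - E)) ∂P
        ≤ Real.exp (c ^ 2 / 4 * s ^ 2 / 2) * Real.exp (s * (G t - E)) := fun t => by
      have h1 : ∀ z, Real.exp (s * (F (Fin.cons z t) - E))
          = Real.exp (s * (F (Fin.cons z t) - G t)) * Real.exp (s * (G t - E)) := fun z => by
        rw [← Real.exp_add]; ring_nf
      simp_rw [h1]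
      rw [integral_mul_const]
      gcongr
      refine integral_exp_sub_integral_le P (hz t) hc (fun z z' => ?_) s
      have := hd (Fin.cons z' t) 0 z
      rwa [Fin.update_cons_zero] at this
    have hint : Integrable (fun t => Real.exp (s * (G t - E))) (Measure.pi fun _ : Fin n => P) :=
      Integrable.of_bound (by fun_prop) _ (Filter.Eventually.of_forall fun t => hexpC _ E (hGC t))
    calc _ ≤ ∫ t, Real.exp (c ^ 2 / 4 * s ^ 2 / 2) * Real.exp (s * (G t - E))
            ∂(Measure.pi fun _ : Fin n => P) := by
          refine integral_mono_of_nonneg (Filter.Eventually.of_forall fun t => ?_)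
            (hint.const_mul _) (Filter.Eventually.of_forall key)
          exact integral_nonneg fun z => (Real.exp_pos _).le
      _ ≤ Real.exp (c ^ 2 / 4 * s ^ 2 / 2) * Real.exp (n * (c ^ 2 / 4) * s ^ 2 / 2) := by
          rw [integral_const_mul]
          gcongr
          exact ih hGm hGC hGd
      _ = _ := by
          rw [← Real.exp_add]; push_cast; ring_nf

/-- McDiarmid's inequality. -/
theorem measure_ge_le_of_bounded_differences {n : ℕ} {F : (Fin n → Z) → ℝ} (hF : Measurable F)
    {c C : ℝ} (hc : 0 ≤ c) (hC : ∀ t, |F t| ≤ C)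
    (hd : ∀ t i z, F (Function.update t i z) - F t ≤ c) {ε : ℝ} (hε : 0 ≤ ε) :
    (Measure.pi fun _ : Fin n => P).real {t | ε ≤ F t - ∫ t, F t ∂(Measure.pi fun _ => P)}
      ≤ Real.exp (-ε ^ 2 / (2 * (n * (c ^ 2 / 4)))) := by
  set E := ∫ t, F t ∂(Measure.pi fun _ => P) with hE
  have hsub : HasSubgaussianMGF (fun t => F t - E) (n * (⟨c, hc⟩ ^ 2 / 4))
      (Measure.pi fun _ : Fin n => P) := by
    constructor
    · intro s
      refine Integrable.of_bound (by fun_prop) (Real.exp (|s| * (C + |E|)))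
        (Filter.Eventually.of_forall fun t => ?_)
      rw [Real.norm_eq_abs, Real.abs_exp, Real.exp_le_exp]
      calc s * (F t - E) ≤ |s| * |F t - E| := by rw [← abs_mul]; exact le_abs_self _
        _ ≤ _ := by gcongr; exact (abs_sub _ _).trans (by gcongr; exact hC t)
    · intro s
      exact integral_exp_le_of_bounded_differences P hF hc hC hd s
  exact hsub.measure_ge_le hε

end Product

/-! ### Suprema over finite classes and contraction. -/

section FiniteSup

variable {W : Type*} [Finite W]

lemma le_ciSup_of_finite (f : W → ℝ) (w : W) : f w ≤ ⨆ w, f w :=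
  le_ciSup (Set.finite_range f).bddAbove w

lemma exists_abs_le_of_finite (A : W → ℝ) : ∃ C, ∀ w, |A w| ≤ C :=
  ⟨⨆ w, |A w|, fun w => le_ciSup_of_finite (fun w => |A w|) w⟩

variable [Nonempty W]

lemma abs_ciSup_le {f : W → ℝ} {C : ℝ} (h : ∀ w, |f w| ≤ C) : |⨆ w, f w| ≤ C := by
  obtain ⟨w, hw⟩ := exists_eq_ciSup_of_finite (f := f)
  exact hw ▸ h w

lemma ciSup_add_sub_le (A e g : W → ℝ) :
    ⨆ w, (A w + e w - g w)
      ≤ 1 / 2 * ((⨆ w, (A w + 2 * e w)) + ⨆ w, (A w - 2 * g w)) := by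
  refine ciSup_le fun w => ?_
  have h1 := le_ciSup_of_finite (fun w => A w + 2 * e w) w
  have h2 := le_ciSup_of_finite (fun w => A w - 2 * g w) w
  linarith

/-- Contraction: a function that is Lipschitz in the `x k` is replaced by a random `± x k`. -/
lemma ciSup_add_ciSup_le_sum {κ : Type*} [Fintype κ] {A h : W → ℝ} {x : κ → W → ℝ} {b : ℝ}
    (hcard : b * Fintype.card κ = 1) (hb : 0 ≤ b)
    (hLip : ∀ w v, |h w - h v| ≤ b * ∑ k, |x k w - x k v|) :
    (⨆ w, (A w + h w)) + (⨆ w, (A w - h w))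
      ≤ b * ∑ k, ((⨆ w, (A w + x k w)) + ⨆ w, (A w - x k w)) := by
  obtain ⟨w, hw⟩ := exists_eq_ciSup_of_finite (f := fun w => A w + h w)
  obtain ⟨v, hv⟩ := exists_eq_ciSup_of_finite (f := fun w => A w - h w)
  rw [← hw, ← hv]
  -- The sign of `x k w - x k v` decides which of the two maximizers tests which supremum. Weighted
  -- by `b`, the copies of `A w + A v` add up to one, by `hcard`.
  have key : ∀ k, A w + A v + |x k w - x k v|
      ≤ (⨆ w, (A w + x k w)) + ⨆ w, (A w - x k w) := fun k => by
    have h1 := le_ciSup_of_finite (fun w => A w + x k w)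
    have h2 := le_ciSup_of_finite (fun w => A w - x k w)
    rcases abs_cases (x k w - x k v) with ⟨h, -⟩ | ⟨h, -⟩
    · linarith [h1 w, h2 v]
    · linarith [h1 v, h2 w]
  have hsum := mul_le_mul_of_nonneg_left (Finset.sum_le_sum fun k (_ : k ∈ Finset.univ) => key k) hb
  rw [Finset.sum_add_distrib, Finset.sum_const, Finset.card_univ, nsmul_eq_mul, mul_add,
    ← mul_assoc, hcard, one_mul] at hsum
  linarith [hLip w v, le_abs_self (h w - h v)]

end FiniteSup

/-! ### Expected uniform deviation, by replacing one example at a time. -/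

section Symmetrization

variable {Z : Type*} [MeasurableSpace Z] (P : Measure Z) [IsProbabilityMeasure P]
  {W : Type*} [Finite W] [Nonempty W]

lemma integrable_ciSup_of_bounded {T : Type*} [MeasurableSpace T] (ν : Measure T)
    [IsFiniteMeasure ν] {X : W → T → ℝ} (hX : ∀ w, Measurable (X w)) {C : ℝ}
    (hC : ∀ w t, |X w t| ≤ C) : Integrable (fun t => ⨆ w, X w t) ν :=
  Integrable.of_bound (Measurable.iSup hX).aestronglyMeasurable C
    (Filter.Eventually.of_forall fun t => abs_ciSup_le fun w => hC w t)

/-- `A + e - g` is the midpoint of `A + 2 * e` and `A - 2 * g`. For `e` the mean of `g`, a supremum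
of means is at most the mean of the supremum, so `e` may be replaced by `g` at the same point `z`.
Both signs then occur at one point, as contraction requires, and no ghost sample is needed. -/
lemma integral_ciSup_add_integral_sub_le {g : W → Z → ℝ} (hg : ∀ w, Measurable (g w))
    (hg1 : ∀ w z, |g w z| ≤ 1) (A : W → ℝ) :
    ∫ z, ⨆ w, (A w + ∫ y, g w y ∂P - g w z) ∂P
      ≤ ∫ z, 1 / 2 * ((⨆ w, (A w + 2 * g w z)) + ⨆ w, (A w - 2 * g w z)) ∂P := by
  obtain ⟨C, hC⟩ := exists_abs_le_of_finite A
  have hgi : ∀ w, Integrable (g w) P := fun w =>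
    Integrable.of_bound (hg w).aestronglyMeasurable 1 (Filter.Eventually.of_forall (hg1 w))
  have he : ∀ w, |∫ y, g w y ∂P| ≤ 1 := fun w => by
    have := norm_integral_le_of_norm_le_const (μ := P) (f := g w)
      (Filter.Eventually.of_forall (hg1 w))
    simpa using this
  have i1 : Integrable (fun z => ⨆ w, (A w + ∫ y, g w y ∂P - g w z)) P := by
    refine integrable_ciSup_of_bounded P (fun w => by fun_prop) (C := C + 2) fun w z => ?_
    have := abs_le.1 (hC w); have := abs_le.1 (he w); have := abs_le.1 (hg1 w z)
    exact abs_le.2 ⟨by linarith, by linarith⟩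
  have i2 : Integrable (fun z => ⨆ w, (A w + 2 * g w z)) P := by
    refine integrable_ciSup_of_bounded P (fun w => by fun_prop) (C := C + 2) fun w z => ?_
    have := abs_le.1 (hC w); have := abs_le.1 (hg1 w z)
    exact abs_le.2 ⟨by linarith, by linarith⟩
  have i3 : Integrable (fun z => ⨆ w, (A w - 2 * g w z)) P := by
    refine integrable_ciSup_of_bounded P (fun w => by fun_prop) (C := C + 2) fun w z => ?_
    have := abs_le.1 (hC w); have := abs_le.1 (hg1 w z)
    exact abs_le.2 ⟨by linarith, by linarith⟩
  have hsup : ⨆ w, (A w + 2 * ∫ y, g w y ∂P) ≤ ∫ z, ⨆ w, (A w + 2 * g w z) ∂P := by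
    refine ciSup_le fun w => ?_
    have : A w + 2 * ∫ y, g w y ∂P = ∫ y, (A w + 2 * g w y) ∂P := by
      rw [integral_add (integrable_const _) ((hgi w).const_mul 2), integral_const_mul]
      simp
    rw [this]
    exact integral_mono ((integrable_const _).add ((hgi w).const_mul 2)) i2
      fun z => le_ciSup_of_finite (fun w => A w + 2 * g w z) w
  calc _ ≤ ∫ z, 1 / 2 * ((⨆ w, (A w + 2 * ∫ y, g w y ∂P)) + ⨆ w, (A w - 2 * g w z)) ∂P :=
        integral_mono i1 (((integrable_const _).add i3).const_mul _)
          fun z => ciSup_add_sub_le A _ fun w => g w z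
    _ = 1 / 2 * ((⨆ w, (A w + 2 * ∫ y, g w y ∂P)) + ∫ z, ⨆ w, (A w - 2 * g w z) ∂P) := by
        rw [integral_const_mul, integral_add (integrable_const _) i3]; simp
    _ ≤ 1 / 2 * (∫ z, ⨆ w, (A w + 2 * g w z) ∂P + ∫ z, ⨆ w, (A w - 2 * g w z) ∂P) := by
        gcongr
    _ = _ := by rw [integral_const_mul, integral_add i2 i3]

variable {H : Type*} [NormedAddCommGroup H] [InnerProductSpace ℝ H]

lemma abs_ciSup_inner_add_le {u : W → H} {B : ℝ} (hu : ∀ w, ‖u w‖ ≤ B) (x : H) {X : W → ℝ}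
    {C : ℝ} (hX : ∀ w, |X w| ≤ C) : |⨆ w, (⟪u w, x⟫_ℝ + X w)| ≤ B * ‖x‖ + C :=
  abs_ciSup_le fun w => (abs_add_le _ _).trans
    (add_le_add ((abs_real_inner_le_norm _ _).trans (by gcongr; exact hu w)) (hX w))

lemma integrable_prod_ciSup_inner_add {T : Type*} [MeasurableSpace T] (ν : Measure T)
    [IsProbabilityMeasure ν] {u : W → H} {B : ℝ} (hu : ∀ w, ‖u w‖ ≤ B) {X : W → T → ℝ}
    (hX : ∀ w, Measurable (X w)) {C : ℝ} (hC : ∀ w t, |X w t| ≤ C)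
    {ψ : Z → H} (hψm : StronglyMeasurable ψ) (hψ : Integrable ψ P) :
    Integrable (fun p : Z × T => ⨆ w, (⟪u w, ψ p.1⟫_ℝ + X w p.2)) (P.prod ν) := by
  have hinner : ∀ w, Measurable fun z => ⟪u w, ψ z⟫_ℝ := fun w =>
    (stronglyMeasurable_const.inner hψm).measurable
  have hb : Integrable (fun p : Z × T => B * ‖ψ p.1‖ + C) (P.prod ν) :=
    (hψ.comp_fst ν).norm.const_mul B |>.add (integrable_const C)
  refine hb.mono' (Measurable.iSup fun w => ?_).aestronglyMeasurable
    (Filter.Eventually.of_forall fun p => abs_ciSup_inner_add_le hu _ fun w => hC w p.2)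
  exact ((hinner w).comp measurable_fst).add ((hX w).comp measurable_snd)

/-- Expected uniform deviation of a Lipschitz function of linear scores `⟪u w, ψ k z⟫`. -/
lemma integral_ciSup_deviation_le {κ : Type*} [Fintype κ] [Nonempty κ] {u : W → H} {B : ℝ}
    (hu : ∀ w, ‖u w‖ ≤ B) {g : W → Z → ℝ} (hg : ∀ w, Measurable (g w))
    (hg1 : ∀ w z, |g w z| ≤ 1) {ψ : κ → Z → H} (hψm : ∀ k, StronglyMeasurable (ψ k))
    (hψ : ∀ k, MemLp (ψ k) 2 P) {L σ : ℝ} (hL : 0 ≤ L)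
    (hLip : ∀ w v z, |g w z - g v z| ≤ L * ∑ k, |⟪u w, ψ k z⟫_ℝ - ⟪u v, ψ k z⟫_ℝ|)
    (hσ : ∀ k, ∫ z, ‖ψ k z‖ ^ 2 ∂P ≤ σ ^ 2) {c : ℝ} (hc : 0 < c) (n : ℕ) (x : H) :
    ∫ t, ⨆ w, (⟪u w, x⟫_ℝ + ∑ i, (∫ y, g w y ∂P - g w (t i))) ∂(Measure.pi fun _ : Fin n => P)
      ≤ B / 2 * ((‖x‖ ^ 2 + n * (2 * L * Fintype.card κ * σ) ^ 2) / c + c) := by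
  have hB : 0 ≤ B := (norm_nonneg _).trans (hu (Classical.arbitrary W))
  have hd : (0 : ℝ) < Fintype.card κ := by exact_mod_cast Fintype.card_pos
  set d : ℝ := (Fintype.card κ : ℝ) with hddef
  have he : ∀ w, |∫ y, g w y ∂P| ≤ 1 := fun w => by
    have := norm_integral_le_of_norm_le_const (μ := P) (f := g w)
      (Filter.Eventually.of_forall (hg1 w))
    simpa using this
  have hXm : ∀ n : ℕ, ∀ w, Measurable fun t : Fin n → Z =>
      ∑ i, (∫ y, g w y ∂P - g w (t i)) := fun n w => by fun_prop
  have hXC : ∀ n : ℕ, ∀ w, ∀ t : Fin n → Z, |∑ i, (∫ y, g w y ∂P - g w (t i))| ≤ n * 2 := by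
    intro n w t
    refine (Finset.abs_sum_le_sum_abs _ _).trans ?_
    refine (Finset.sum_le_card_nsmul _ _ 2 fun i _ => ?_).trans_eq (by simp)
    have := abs_le.1 (he w); have := abs_le.1 (hg1 w (t i))
    exact abs_le.2 ⟨by linarith, by linarith⟩
  -- The vector `x` carries the scores of the examples already replaced. The bound is quadratic in
  -- `‖x‖`, with AM-GM and a free `c` in place of a square root, so that averaging over signs and
  -- over `z` reproduces its form.
  induction n generalizing x with
  | zero =>
    simp only [Finset.univ_eq_empty, Finset.sum_empty, add_zero, integral_const, probReal_univ,
      one_smul, Nat.cast_zero, zero_mul]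
    refine ciSup_le fun w => ?_
    calc ⟪u w, x⟫_ℝ ≤ B * ‖x‖ := (real_inner_le_norm _ _).trans (by gcongr; exact hu w)
      _ ≤ _ := by
        have : ‖x‖ ≤ (‖x‖ ^ 2 / c + c) / 2 := by
          rw [div_add' _ _ _ hc.ne', div_div, le_div_iff₀ (by positivity)]
          nlinarith [sq_nonneg (‖x‖ - c)]
        nlinarith
  | succ n ih =>
    set X : W → (Fin n → Z) → ℝ := fun w t => ∑ i, (∫ y, g w y ∂P - g w (t i)) with hX
    set ν := (Measure.pi fun _ : Fin n => P) with hν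
    -- The factors are 2 from symmetrization, the Lipschitz constant `L`, and `d` to offset the
    -- weight `1 / d` in the contraction.
    set s : ℝ := 2 * L * d with hs
    set Q : H → (Fin n → Z) → ℝ := fun y t => ⨆ w, (⟪u w, y⟫_ℝ + X w t) with hQ
    have hshift : ∀ (r : ℝ) k, StronglyMeasurable fun z => x + r • ψ k z := fun r k =>
      stronglyMeasurable_const.add ((hψm k).const_smul r)
    have hint : ∀ (r : ℝ) k, Integrable (fun p : Z × (Fin n → Z) => Q (x + r • ψ k p.1) p.2)
        (P.prod ν) := fun r k =>
      integrable_prod_ciSup_inner_add P ν hu (hXm n) (hXC n) (hshift r k)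
        ((integrable_const x).add (((hψ k).integrable one_le_two).smul r))
    have hint2 : Integrable (fun p : Z × (Fin n → Z) =>
        1 / (2 * d) * ∑ k, (Q (x + s • ψ k p.1) p.2 + Q (x + (-s) • ψ k p.1) p.2))
        (P.prod ν) :=
      (integrable_finsetSum _ fun k _ => (hint s k).add (hint (-s) k)).const_mul _
    have hQi : ∀ y, Integrable (Q y) ν := fun y => by
      refine integrable_ciSup_of_bounded ν (C := B * ‖y‖ + n * 2)
        (fun w => measurable_const.add (hXm n w)) fun w t => ?_
      exact (abs_add_le _ _).trans (add_le_add ((abs_real_inner_le_norm _ _).trans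
        (by gcongr; exact hu w)) (hXC n w t))
    have hint1 : Integrable (fun p : Z × (Fin n → Z) =>
        ⨆ w, ((⟪u w, x⟫_ℝ + X w p.2) + ∫ y, g w y ∂P - g w p.1)) (P.prod ν) := by
      refine integrable_ciSup_of_bounded _ (C := B * ‖x‖ + n * 2 + 2)
        (fun w => ((measurable_const.add ((hXm n w).comp measurable_snd)).add_const _).sub
          ((hg w).comp measurable_fst)) fun w p => ?_
      have h0 : |⟪u w, x⟫_ℝ| ≤ B * ‖x‖ :=
        (abs_real_inner_le_norm _ _).trans (by gcongr; exact hu w)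
      have := abs_le.1 h0; have := abs_le.1 (hXC n w p.2)
      have := abs_le.1 (he w); have := abs_le.1 (hg1 w p.1)
      exact abs_le.2 ⟨by linarith, by linarith⟩
    have hpt : ∀ z t, 1 / 2 * ((⨆ w, ((⟪u w, x⟫_ℝ + X w t) + 2 * g w z))
          + ⨆ w, ((⟪u w, x⟫_ℝ + X w t) - 2 * g w z))
        ≤ 1 / (2 * d) * ∑ k, (Q (x + s • ψ k z) t + Q (x + (-s) • ψ k z) t) := fun z t => by
      have h := ciSup_add_ciSup_le_sum (A := fun w => ⟪u w, x⟫_ℝ + X w t)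
        (h := fun w => 2 * g w z) (x := fun k w => s * ⟪u w, ψ k z⟫_ℝ) (b := 1 / d)
        (one_div_mul_cancel hd.ne') (by positivity) (fun w v => by
          have h2 := hLip w v z
          simp_rw [← mul_sub, abs_mul, ← Finset.mul_sum]
          rw [abs_of_nonneg (show 0 ≤ s by positivity), hs, abs_two]
          calc _ ≤ 2 * (L * ∑ k, |⟪u w, ψ k z⟫_ℝ - ⟪u v, ψ k z⟫_ℝ|) := by gcongr
            _ = _ := by field_simp)
      have e1 : ∀ k, (⨆ w, ((⟪u w, x⟫_ℝ + X w t) + s * ⟪u w, ψ k z⟫_ℝ)) = Q (x + s • ψ k z) t :=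
        fun k => by
          simp only [hQ, inner_add_right, real_inner_smul_right]
          congr! 2 with w
          ring
      have e2 : ∀ k, (⨆ w, ((⟪u w, x⟫_ℝ + X w t) - s * ⟪u w, ψ k z⟫_ℝ))
          = Q (x + (-s) • ψ k z) t :=
        fun k => by
          simp only [hQ, inner_add_right, real_inner_smul_right]
          congr! 2 with w
          ring
      simp only [e1, e2] at h
      calc _ ≤ 1 / 2 * (1 / d * ∑ k, (Q (x + s • ψ k z) t + Q (x + (-s) • ψ k z) t)) := by
            gcongr
        _ = _ := by ring
    -- Fubini yields integrable sections only for almost every `t`.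
    have hstep : ∀ᵐ t ∂ν, ∫ z, ⨆ w, ((⟪u w, x⟫_ℝ + X w t) + ∫ y, g w y ∂P - g w z) ∂P
        ≤ ∫ z, 1 / (2 * d) * ∑ k, (Q (x + s • ψ k z) t + Q (x + (-s) • ψ k z) t) ∂P := by
      filter_upwards [hint2.prod_left_ae] with t ht
      refine (integral_ciSup_add_integral_sub_le P hg hg1 _).trans
        (integral_mono ?_ ht fun z => hpt z t)
      obtain ⟨C, hC⟩ := exists_abs_le_of_finite fun w => ⟪u w, x⟫_ℝ + X w t
      refine ((integrable_ciSup_of_bounded P (fun w => by fun_prop) (C := C + 2)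
        fun w z => ?_).add (integrable_ciSup_of_bounded P (fun w => by fun_prop) (C := C + 2)
        fun w z => ?_)).const_mul _
      all_goals
        have := abs_le.1 (hC w); have := abs_le.1 (hg1 w z)
        exact abs_le.2 ⟨by linarith, by linarith⟩
    have hrec : ∀ z, ∫ t, 1 / (2 * d) * ∑ k, (Q (x + s • ψ k z) t + Q (x + (-s) • ψ k z) t) ∂ν
        ≤ B / 2 * ((‖x‖ ^ 2 + n * (s * σ) ^ 2) / c + c)
            + B / 2 / c * (s ^ 2 / d) * ∑ k, ‖ψ k z‖ ^ 2 := fun z => by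
      have hpair : ∀ y y', Integrable (fun t => Q y t + Q y' t) ν := fun y y' =>
        (hQi y).add (hQi y')
      rw [integral_const_mul, integral_finsetSum _ fun k _ => hpair _ _]
      simp_rw [integral_add (hQi _) (hQi _)]
      have hk : ∀ k, ∫ t, Q (x + s • ψ k z) t ∂ν + ∫ t, Q (x + (-s) • ψ k z) t ∂ν
          ≤ B * ((‖x‖ ^ 2 + s ^ 2 * ‖ψ k z‖ ^ 2 + n * (s * σ) ^ 2) / c + c) := fun k => by
        -- The cross terms with `x` cancel between the two signs.
        have hp := parallelogram_law_with_norm ℝ x (s • ψ k z)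
        rw [norm_smul, sub_eq_add_neg, ← neg_smul, Real.norm_eq_abs] at hp
        simp only [mul_pow, sq_abs] at hp
        calc _ ≤ B / 2 * ((‖x + s • ψ k z‖ ^ 2 + n * (s * σ) ^ 2) / c + c)
              + B / 2 * ((‖x + (-s) • ψ k z‖ ^ 2 + n * (s * σ) ^ 2) / c + c) :=
              add_le_add (ih _) (ih _)
          _ = B / 2 * ((‖x + s • ψ k z‖ ^ 2 + ‖x + (-s) • ψ k z‖ ^ 2
                + 2 * (n * (s * σ) ^ 2)) / c + 2 * c) := by ring
          _ = _ := by rw [hp]; ring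
      calc _ ≤ 1 / (2 * d) *
            ∑ k, B * ((‖x‖ ^ 2 + s ^ 2 * ‖ψ k z‖ ^ 2 + n * (s * σ) ^ 2) / c + c) := by
            gcongr with k; exact hk k
        _ = 1 / (2 * d) * ∑ k, (B * ((‖x‖ ^ 2 + n * (s * σ) ^ 2) / c + c)
              + B / c * s ^ 2 * ‖ψ k z‖ ^ 2) := by
            congr 1; exact Finset.sum_congr rfl fun k _ => by ring
        _ = _ := by
            rw [Finset.sum_add_distrib, Finset.sum_const, Finset.card_univ, nsmul_eq_mul,
              ← Finset.mul_sum, ← hddef]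
            field_simp
    have hsq : Integrable (fun z => ∑ k, ‖ψ k z‖ ^ 2) P :=
      integrable_finsetSum _ fun k _ => (hψ k).integrable_norm_pow two_ne_zero
    calc ∫ t, ⨆ w, (⟪u w, x⟫_ℝ + ∑ i, (∫ y, g w y ∂P - g w (t i)))
            ∂(Measure.pi fun _ : Fin (n + 1) => P)
        = ∫ t, ∫ z, ⨆ w, ((⟪u w, x⟫_ℝ + X w t) + ∫ y, g w y ∂P - g w z) ∂P ∂ν := by
          rw [integral_finCons P (fun t => ⨆ w, (⟪u w, x⟫_ℝ + ∑ i, (∫ y, g w y ∂P - g w (t i))))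
            (Measurable.iSup fun w => measurable_const.add (hXm _ w))
            (fun t => abs_ciSup_inner_add_le hu x fun w => hXC (n + 1) w t)]
          congr! 6 with t z w
          rw [Fin.sum_univ_succ]
          simp only [Fin.cons_zero, Fin.cons_succ, hX]
          ring
      _ ≤ ∫ t, ∫ z, 1 / (2 * d) * ∑ k, (Q (x + s • ψ k z) t + Q (x + (-s) • ψ k z) t) ∂P ∂ν :=
          integral_mono_ae hint1.integral_prod_right hint2.integral_prod_right hstep
      _ = ∫ z, ∫ t, 1 / (2 * d) * ∑ k, (Q (x + s • ψ k z) t + Q (x + (-s) • ψ k z) t) ∂ν ∂P :=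
          (integral_integral_swap hint2).symm
      _ ≤ ∫ z, (B / 2 * ((‖x‖ ^ 2 + n * (s * σ) ^ 2) / c + c)
            + B / 2 / c * (s ^ 2 / d) * ∑ k, ‖ψ k z‖ ^ 2) ∂P :=
          integral_mono hint2.integral_prod_left
            ((integrable_const _).add (hsq.const_mul _)) hrec
      _ ≤ _ := by
          rw [integral_add (integrable_const _) (hsq.const_mul _),
            integral_const_mul (B / 2 / c * (s ^ 2 / d)),
            integral_finsetSum _ fun k _ => (hψ k).integrable_norm_pow two_ne_zero]
          have : ∑ k, ∫ z, ‖ψ k z‖ ^ 2 ∂P ≤ d * σ ^ 2 :=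
            (Finset.sum_le_card_nsmul _ _ _ fun k _ => hσ k).trans_eq (by simp [hddef])
          calc _ ≤ B / 2 * ((‖x‖ ^ 2 + n * (s * σ) ^ 2) / c + c)
                + B / 2 / c * (s ^ 2 / d) * (d * σ ^ 2) := by
                  simp only [integral_const, probReal_univ, one_smul]
                  gcongr
            _ = _ := by
                  push_cast
                  field_simp
                  ring

end Symmetrization

/-- At a maximizer for the updated sample only the `i`-th summand changes, and losses lie in `[0,
1]`. This is the constant `c = 1` for McDiarmid. -/
lemma ciSup_deviation_update_sub_le {Z W : Type*} [Finite W] [Nonempty W] {g : W → Z → ℝ}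
    (hg01 : ∀ w z, g w z ∈ Set.Icc (0 : ℝ) 1) (e : W → ℝ) {n : ℕ} (t : Fin n → Z) (i : Fin n)
    (z : Z) :
    (⨆ w, ∑ j, (e w - g w (Function.update t i z j))) - ⨆ w, ∑ j, (e w - g w (t j)) ≤ 1 := by
  obtain ⟨w, hw⟩ := exists_eq_ciSup_of_finite
    (f := fun w => ∑ j, (e w - g w (Function.update t i z j)))
  rw [← hw]
  have h1 := le_ciSup_of_finite (fun w => ∑ j, (e w - g w (t j))) w
  have h2 : ∑ j, (e w - g w (Function.update t i z j)) - ∑ j, (e w - g w (t j))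
      = g w (t i) - g w z := by
    rw [← Finset.sum_sub_distrib, Finset.sum_eq_single i]
    · simp
    · intro j _ hj
      simp [Function.update_of_ne hj]
    · simp
  linarith [(hg01 w (t i)).2, (hg01 w z).1]

/-! ### High-probability bounds, from finite to separable classes. -/

section Uniform

variable {Z : Type*} [MeasurableSpace Z] (P : Measure Z) [IsProbabilityMeasure P]
  {H : Type*} [NormedAddCommGroup H] [InnerProductSpace ℝ H]
  {κ : Type*} [Fintype κ] [Nonempty κ]

/-- Uniform deviation bound for a finite class. -/
lemma measure_deviation_gt_le_of_finite {W : Type*} [Finite W] [Nonempty W] {u : W → H} {B : ℝ}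
    (hu : ∀ w, ‖u w‖ ≤ B) {g : W → Z → ℝ} (hg : ∀ w, Measurable (g w))
    (hg01 : ∀ w z, g w z ∈ Set.Icc (0 : ℝ) 1) {ψ : κ → Z → H}
    (hψm : ∀ k, StronglyMeasurable (ψ k)) (hψ : ∀ k, MemLp (ψ k) 2 P) {L σ : ℝ} (hL : 0 ≤ L)
    (hσ0 : 0 ≤ σ)
    (hLip : ∀ w v z, |g w z - g v z| ≤ L * ∑ k, |⟪u w, ψ k z⟫_ℝ - ⟪u v, ψ k z⟫_ℝ|)
    (hσ : ∀ k, ∫ z, ‖ψ k z‖ ^ 2 ∂P ≤ σ ^ 2) {n : ℕ} (hn : 0 < n) {δ : ℝ} (hδ : 0 < δ)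
    (hδ1 : δ ≤ 1) :
    (Measure.pi fun _ : Fin n => P) {t | ∃ w, 1 / (n : ℝ) * ∑ i, g w (t i)
        + B * (2 * L * Fintype.card κ * σ) / √n + √(Real.log (1 / δ) / (2 * n))
          < ∫ z, g w z ∂P} ≤ ENNReal.ofReal δ := by
  have hg1 : ∀ w z, |g w z| ≤ 1 := fun w z =>
    abs_le.2 ⟨by linarith [(hg01 w z).1], (hg01 w z).2⟩
  have hn' : (0 : ℝ) < n := by exact_mod_cast hn
  set K : ℝ := 2 * L * Fintype.card κ * σ with hK
  have hK0 : 0 ≤ K := by positivity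
  have hB : 0 ≤ B := (norm_nonneg _).trans (hu (Classical.arbitrary W))
  set F : (Fin n → Z) → ℝ := fun t => ⨆ w, ∑ i, (∫ y, g w y ∂P - g w (t i)) with hF
  set ν := (Measure.pi fun _ : Fin n => P) with hν
  have hFm : Measurable F := Measurable.iSup fun w => by fun_prop
  have he : ∀ w, |∫ y, g w y ∂P| ≤ 1 := fun w => by
    have := norm_integral_le_of_norm_le_const (μ := P) (f := g w)
      (Filter.Eventually.of_forall (hg1 w))
    simpa using this
  have hFC : ∀ t, |F t| ≤ n * 2 := fun t => abs_ciSup_le fun w => by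
    refine (Finset.abs_sum_le_sum_abs _ _).trans ?_
    refine (Finset.sum_le_card_nsmul _ _ 2 fun i _ => ?_).trans_eq (by simp)
    have := abs_le.1 (he w); have := abs_le.1 (hg1 w (t i))
    exact abs_le.2 ⟨by linarith, by linarith⟩
  have hEF : ∫ t, F t ∂ν ≤ B * (√n * K) := by
    have h : ∀ c, 0 < c → ∫ t, F t ∂ν ≤ B / 2 * ((√n * K) ^ 2 / c + c) := fun c hc => by
      have := integral_ciSup_deviation_le P hu hg hg1 hψm hψ hL hLip hσ hc n 0
      rw [mul_pow, Real.sq_sqrt hn'.le]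
      simpa only [inner_zero_right, zero_add, norm_zero, zero_pow two_ne_zero] using this
    refine le_of_forall_pos_le_add fun ε hε => ?_
    have hq : 0 ≤ √n * K := by positivity
    set q := √n * K
    -- The optimal `c` is `q`, which may be 0, hence `c = q + r`. The denominator `B + 1` covers `B
    -- = 0`.
    set r := ε / (B + 1) with hr
    have hr0 : 0 < r := by positivity
    refine (h (q + r) (by positivity)).trans ?_
    have h1 : q ^ 2 / (q + r) ≤ q := by
      rw [div_le_iff₀ (by positivity)]
      nlinarith
    have h2 : B * r ≤ ε := by
      rw [hr, mul_div_assoc', div_le_iff₀ (by positivity)]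
      nlinarith
    calc B / 2 * (q ^ 2 / (q + r) + (q + r)) ≤ B / 2 * (q + (q + r)) := by gcongr
      _ ≤ B * q + ε := by nlinarith
  have hlog : 0 ≤ Real.log (1 / δ) := Real.log_nonneg ((one_le_div hδ).2 hδ1)
  -- `F` is not divided by `n`, so the threshold is `n` times the final logarithmic term.
  have hmc := measure_ge_le_of_bounded_differences P hFm zero_le_one hFC
    (fun t i z => ciSup_deviation_update_sub_le hg01 (fun w => ∫ y, g w y ∂P) t i z)
    (Real.sqrt_nonneg (n * Real.log (1 / δ) / 2))
  have hexp : Real.exp (-√(n * Real.log (1 / δ) / 2) ^ 2 / (2 * (n * (1 ^ 2 / 4)))) = δ := by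
    rw [Real.sq_sqrt (by positivity)]
    have : -(n * Real.log (1 / δ) / 2) / (2 * (n * (1 ^ 2 / 4))) = Real.log δ := by
      rw [one_div, Real.log_inv]
      field_simp
      norm_num
    rw [this, Real.exp_log hδ]
  rw [hexp] at hmc
  have hsub : {t : Fin n → Z | ∃ w, 1 / (n : ℝ) * ∑ i, g w (t i)
        + B * K / √n + √(Real.log (1 / δ) / (2 * n)) < ∫ z, g w z ∂P}
      ⊆ {t | √(n * Real.log (1 / δ) / 2) ≤ F t - ∫ t, F t ∂ν} := by
    rintro t ⟨w, hw⟩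
    have h1 : ∑ i, (∫ y, g w y ∂P - g w (t i)) ≤ F t :=
      le_ciSup_of_finite (fun w => ∑ i, (∫ y, g w y ∂P - g w (t i))) w
    rw [Finset.sum_sub_distrib, Finset.sum_const, Finset.card_univ, Fintype.card_fin,
      nsmul_eq_mul] at h1
    have h2 := mul_lt_mul_of_pos_left hw hn'
    have h3 : (n : ℝ) * √(Real.log (1 / δ) / (2 * n)) = √(n * Real.log (1 / δ) / 2) := by
      rw [← Real.sqrt_sq hn'.le, ← Real.sqrt_mul (by positivity), Real.sqrt_sq hn'.le]
      congr 1
      field_simp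
    have h4 : (n : ℝ) * (B * K / √n) = B * (√n * K) := by
      have : (n : ℝ) = √n * √n := (Real.mul_self_sqrt hn'.le).symm
      have h0 : √(n : ℝ) ≠ 0 := (Real.sqrt_pos.2 hn').ne'
      field_simp
      rw [Real.sq_sqrt hn'.le]
      ring
    have h5 : (n : ℝ) * (1 / n * ∑ i, g w (t i)) = ∑ i, g w (t i) := by field_simp
    rw [mul_add, mul_add, h3, h4, h5] at h2
    simp only [Set.mem_ofPred_eq]
    linarith
  calc _ ≤ ν {t | √(n * Real.log (1 / δ) / 2) ≤ F t - ∫ t, F t ∂ν} := measure_mono hsub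
    _ = ENNReal.ofReal (ν.real {t | √(n * Real.log (1 / δ) / 2) ≤ F t - ∫ t, F t ∂ν}) :=
        (ENNReal.ofReal_toReal (measure_ne_top _ _)).symm
    _ ≤ _ := ENNReal.ofReal_le_ofReal hmc

variable {U : Type*} [TopologicalSpace U] [FirstCountableTopology U]

lemma continuous_integral_of_mem_Icc {g : U → Z → ℝ}
    (hg : ∀ u, Measurable (g u))
    (hg01 : ∀ u z, g u z ∈ Set.Icc (0 : ℝ) 1) (hgc : ∀ z, Continuous fun u => g u z) :
    Continuous fun u => ∫ z, g u z ∂P :=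
  continuous_of_dominated (fun u => (hg u).aestronglyMeasurable) (bound := fun _ => 1)
    (fun u => Filter.Eventually.of_forall fun z => by
      rw [Real.norm_of_nonneg (hg01 u z).1]; exact (hg01 u z).2)
    (integrable_const 1) (Filter.Eventually.of_forall hgc)

/-- The samples on which the empirical means exceed all the expectations up to `r`. -/
def uniformGood {U : Type*} (ι : Type*) [Fintype ι] (g : U → Z → ℝ) (r : ℝ) : Set (ι → Z) :=
  {t | ∀ u, ∫ z, g u z ∂P ≤ 1 / (Fintype.card ι : ℝ) * ∑ i, g u (t i) + r}

variable [TopologicalSpace.SeparableSpace U] [Nonempty U]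

/-- Both sides of the inequality are continuous in `u`, so it is a closed condition and a dense
sequence suffices. This gives measurability and the reduction to finite classes. -/
lemma uniformGood_eq_iInter {ι : Type*} [Fintype ι] {g : U → Z → ℝ}
    (hg : ∀ u, Measurable (g u)) (hg01 : ∀ u z, g u z ∈ Set.Icc (0 : ℝ) 1)
    (hgc : ∀ z, Continuous fun u => g u z) (r : ℝ) :
    uniformGood P ι g r = ⋂ j : ℕ, {t | ∫ z, g (TopologicalSpace.denseSeq U j) z ∂P
      ≤ 1 / (Fintype.card ι : ℝ) * ∑ i, g (TopologicalSpace.denseSeq U j) (t i) + r} := by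
  ext t
  simp only [uniformGood, Set.mem_ofPred_eq, Set.mem_iInter]
  refine ⟨fun h j => h _, fun h u => ?_⟩
  have hcl : IsClosed {u | ∫ z, g u z ∂P ≤ 1 / (Fintype.card ι : ℝ) * ∑ i, g u (t i) + r} :=
    isClosed_le (continuous_integral_of_mem_Icc P hg hg01 hgc)
      ((continuous_const.mul (continuous_finsetSum _ fun i _ => hgc (t i))).add_const r)
  exact (TopologicalSpace.denseRange_denseSeq U).induction_on u hcl h

lemma measurableSet_uniformGood {ι : Type*} [Fintype ι]
    {g : U → Z → ℝ}
    (hg : ∀ u, Measurable (g u)) (hg01 : ∀ u z, g u z ∈ Set.Icc (0 : ℝ) 1)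
    (hgc : ∀ z, Continuous fun u => g u z) (r : ℝ) : MeasurableSet (uniformGood P ι g r) := by
  rw [uniformGood_eq_iInter P hg hg01 hgc]
  exact MeasurableSet.iInter fun j => measurableSet_le measurable_const (by fun_prop)

/-- Uniform deviation bound for a separable class of Lipschitz functions of linear scores. -/
theorem le_measure_uniformGood {ι : Type*} [Fintype ι] [Nonempty ι]
    {u : U → H} {B : ℝ}
    (hu : ∀ w, ‖u w‖ ≤ B) {g : U → Z → ℝ} (hg : ∀ w, Measurable (g w))
    (hg01 : ∀ w z, g w z ∈ Set.Icc (0 : ℝ) 1) (hgc : ∀ z, Continuous fun u => g u z)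
    {ψ : κ → Z → H}
    (hψm : ∀ k, StronglyMeasurable (ψ k)) (hψ : ∀ k, MemLp (ψ k) 2 P) {L σ : ℝ} (hL : 0 ≤ L)
    (hσ0 : 0 ≤ σ)
    (hLip : ∀ w v z, |g w z - g v z| ≤ L * ∑ k, |⟪u w, ψ k z⟫_ℝ - ⟪u v, ψ k z⟫_ℝ|)
    (hσ : ∀ k, ∫ z, ‖ψ k z‖ ^ 2 ∂P ≤ σ ^ 2) {δ : ℝ} (hδ : 0 < δ) (hδ1 : δ ≤ 1) {r : ℝ}
    (hr : B * (2 * L * Fintype.card κ * σ) / √(Fintype.card ι)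
      + √(Real.log (1 / δ) / (2 * Fintype.card ι)) ≤ r) :
    ENNReal.ofReal (1 - δ) ≤ (Measure.pi fun _ : ι => P) (uniformGood P ι g r) := by
  set n := Fintype.card ι with hn
  let e : Fin n ≃ ι := (Fintype.equivFin ι).symm
  have hgood := uniformGood_eq_iInter P (ι := ι) hg hg01 hgc r
  have hmeas := measurableSet_uniformGood P (ι := ι) hg hg01 hgc r
  set D := TopologicalSpace.denseSeq U with hD
  have hmp := measurePreserving_piCongrLeft (fun _ : ι => P) e
  have happ : ∀ (t : Fin n → Z) i, MeasurableEquiv.piCongrLeft (fun _ : ι => Z) e t i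
      = t (e.symm i) := fun t i => by
    obtain ⟨j, rfl⟩ := e.surjective i
    simp [MeasurableEquiv.coe_piCongrLeft, Equiv.piCongrLeft_apply_apply]
  have hbad : (Measure.pi fun _ : ι => P) (uniformGood P ι g r)ᶜ ≤ ENNReal.ofReal δ := by
    rw [← hmp.measure_preimage hmeas.compl.nullMeasurableSet]
    -- These events increase with `N` and their bound `δ` does not depend on the size of the class,
    -- so it passes to the union.
    set bad : ℕ → Set (Fin n → Z) := fun N => {t | ∃ w : Fin (N + 1),
      1 / (n : ℝ) * ∑ i, g (D w) (t i) + B * (2 * L * Fintype.card κ * σ) / √n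
        + √(Real.log (1 / δ) / (2 * n)) < ∫ z, g (D w) z ∂P} with hbaddef
    have hmono : Monotone bad := fun N M hNM t ⟨w, hw⟩ =>
      ⟨Fin.castLE (by omega) w, hw⟩
    have hsub : MeasurableEquiv.piCongrLeft (fun _ : ι => Z) e ⁻¹' (uniformGood P ι g r)ᶜ
        ⊆ ⋃ N, bad N := by
      intro t ht
      rw [Set.mem_preimage, hgood, Set.mem_compl_iff, Set.mem_iInter] at ht
      push Not at ht
      obtain ⟨j, hj⟩ := ht
      refine Set.mem_iUnion.2 ⟨j, Fin.last j, ?_⟩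
      simp only [Set.mem_ofPred_eq, not_le, happ] at hj
      rw [Equiv.sum_comp e.symm (fun i => g (D j) (t i))] at hj
      simp only [Fin.val_last]
      linarith
    refine (measure_mono hsub).trans ?_
    rw [hmono.measure_iUnion]
    refine iSup_le fun N => ?_
    exact measure_deviation_gt_le_of_finite P (u := fun w : Fin (N + 1) => u (D w))
      (g := fun w => g (D w)) (fun w => hu _) (fun w => hg _) (fun w => hg01 _) hψm hψ hL hσ0
      (fun w v => hLip _ _) hσ Fintype.card_pos hδ hδ1
  have hc := prob_compl_eq_one_sub (μ := Measure.pi fun _ : ι => P) hmeas.compl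
  rw [compl_compl] at hc
  rw [hc, ENNReal.ofReal_sub _ hδ.le, ENNReal.ofReal_one]
  exact tsub_le_tsub_left hbad 1

end Uniform

/-! ### Lipschitz properties of margin and ramp loss. -/

section Margin

lemma rampLoss_mem_Icc {ρ : ℝ} (hρ : 0 < ρ) (t : ℝ) : rampLoss ρ t ∈ Set.Icc (0 : ℝ) 1 := by
  unfold rampLoss
  split_ifs with h1 h2
  · simp
  · have : t / ρ ≤ 1 := (div_le_one hρ).2 (not_le.1 h1).le
    have : 0 ≤ t / ρ := by positivity
    constructor <;> linarith
  · simp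

lemma rampLoss_eq_one_sub {ρ : ℝ} (hρ : 0 < ρ) (t : ℝ) :
    rampLoss ρ t = 1 - max 0 (min ρ t) / ρ := by
  unfold rampLoss
  split_ifs with h1 h2
  · rw [min_eq_left h1, max_eq_right hρ.le, div_self hρ.ne', sub_self]
  · rw [min_eq_right (not_le.1 h1).le, max_eq_right h2]
  · rw [min_eq_right (not_le.1 h1).le, max_eq_left (not_le.1 h2).le, zero_div, sub_zero]

lemma abs_rampLoss_sub_le {ρ : ℝ} (hρ : 0 < ρ) (t s : ℝ) :
    |rampLoss ρ t - rampLoss ρ s| ≤ 1 / ρ * |t - s| := by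
  rw [rampLoss_eq_one_sub hρ, rampLoss_eq_one_sub hρ, sub_sub_sub_cancel_left, ← sub_div,
    abs_div, abs_of_pos hρ, abs_sub_comm, one_div, inv_mul_eq_div]
  refine div_le_div_of_nonneg_right ?_ hρ.le
  calc |max 0 (min ρ t) - max 0 (min ρ s)| ≤ |min ρ t - min ρ s| := by
        simpa using abs_max_sub_max_le_max 0 (min ρ t) 0 (min ρ s)
    _ ≤ |t - s| := by simpa using abs_min_sub_min_le_max ρ t ρ s

lemma zeroOneLoss_nonneg {d : ℕ} (z : Fin d → ℝ) (y : Fin d) : 0 ≤ zeroOneLoss z y := by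
  unfold zeroOneLoss; split_ifs <;> simp

lemma zeroOneLoss_le_rampLoss {d : ℕ} {ρ : ℝ} (hρ : 0 < ρ) (z : Fin d → ℝ) (y : Fin d) :
    zeroOneLoss z y ≤ rampLoss ρ (classMargin z y) := by
  unfold zeroOneLoss
  split_ifs with h
  · obtain ⟨k, hk, hle⟩ := h
    have h1 := le_ciSup_of_finite (fun k : {k : Fin d // k ≠ y} => z k) ⟨k, hk⟩
    have h2 : classMargin z y ≤ 0 := by unfold classMargin; linarith
    rw [rampLoss_eq_one_sub hρ, min_eq_right (h2.trans hρ.le), max_eq_left h2]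
    simp
  · exact (rampLoss_mem_Icc hρ _).1

variable {d : ℕ} [Nontrivial (Fin d)]

lemma nonempty_ne_label (y : Fin d) : Nonempty {k : Fin d // k ≠ y} :=
  let ⟨k, hk⟩ := exists_ne y
  ⟨⟨k, hk⟩⟩

/-- The score of `y` and the maximum over the other labels use disjoint coordinates, so each
difference is paid for once and no factor 2 arises. -/
lemma classMargin_sub_le (z z' : Fin d → ℝ) (y : Fin d) :
    classMargin z y - classMargin z' y ≤ ∑ k, |z k - z' k| := by
  have := nonempty_ne_label y
  have h : ⨆ k : {k : Fin d // k ≠ y}, z' k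
      ≤ (⨆ k : {k : Fin d // k ≠ y}, z k) + ∑ k ∈ Finset.univ.erase y, |z k - z' k| := by
    refine ciSup_le fun k => ?_
    have h1 := le_ciSup_of_finite (fun k : {k : Fin d // k ≠ y} => z k) k
    have h2 := Finset.single_le_sum (f := fun k => |z k - z' k|) (fun k _ => abs_nonneg _)
      (Finset.mem_erase.2 ⟨k.2, Finset.mem_univ _⟩)
    linarith [neg_abs_le (z k - z' k)]
  rw [← Finset.add_sum_erase _ _ (Finset.mem_univ y)]
  unfold classMargin
  linarith [le_abs_self (z y - z' y)]

lemma abs_classMargin_sub_le (z z' : Fin d → ℝ) (y : Fin d) :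
    |classMargin z y - classMargin z' y| ≤ ∑ k, |z k - z' k| := by
  refine abs_sub_le_iff.2 ⟨classMargin_sub_le z z' y, ?_⟩
  simpa only [abs_sub_comm] using classMargin_sub_le z' z y

lemma abs_rampLoss_classMargin_sub_le {ρ : ℝ} (hρ : 0 < ρ) (z z' : Fin d → ℝ) (y : Fin d) :
    |rampLoss ρ (classMargin z y) - rampLoss ρ (classMargin z' y)|
      ≤ 1 / ρ * ∑ k, |z k - z' k| :=
  (abs_rampLoss_sub_le hρ _ _).trans (by gcongr; exact abs_classMargin_sub_le z z' y)

lemma continuous_rampLoss_classMargin {ρ : ℝ} (hρ : 0 < ρ) (y : Fin d) :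
    Continuous fun z : Fin d → ℝ => rampLoss ρ (classMargin z y) := by
  rw [continuous_iff_continuousAt]
  intro z
  rw [ContinuousAt, tendsto_iff_dist_tendsto_zero]
  refine squeeze_zero (fun _ => dist_nonneg)
    (fun z' => abs_rampLoss_classMargin_sub_le hρ z' z y) ?_
  have : Continuous fun z' : Fin d → ℝ => 1 / ρ * ∑ k, |z' k - z k| := by fun_prop
  simpa using this.tendsto z

lemma measurable_rampLoss_classMargin {ρ : ℝ} (hρ : 0 < ρ) :
    Measurable fun p : (Fin d → ℝ) × Fin d => rampLoss ρ (classMargin p.1 p.2) :=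
  measurable_from_prod_countable_left fun y => (continuous_rampLoss_classMargin hρ y).measurable

end Margin

/-! ### Measurability of the path features. -/

namespace DeepNet

variable (N : DeepNet)

open Classical in
lemma measurable_gate (l : ℕ) (j : Fin (N.width l)) :
    Measurable fun z : Fin (N.width l) → ℝ => N.gate l z j := by
  unfold gate
  refine Measurable.ite ?_ measurable_const measurable_const
  measurability

lemma measurable_preact (w : N.Weights) (l : ℕ) :
    Measurable fun x : N.Input => N.preact w x l := by
  induction l using Nat.strong_induction_on with
  | _ l ih =>
    cases l with
    | zero => simp only [preact]; exact measurable_id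
    | succ l =>
      simp only [preact]
      refine measurable_pi_lambda _ fun j => Finset.measurable_fun_sum _ fun l' _ =>
        Finset.measurable_fun_sum _ fun j' _ => ?_
      split_ifs
      · have h := ih l' l'.isLt
        exact measurable_const.mul (((N.measurable_gate l' j').comp h).mul
          ((measurable_pi_apply j').comp h))
      · exact measurable_const

lemma measurable_activation (w : N.Weights) {l : ℕ} {j : Fin (N.width l)} (r : N.Route l j) :
    Measurable fun x : N.Input => r.activation w x := by
  induction r with
  | input i => exact measurable_const
  | @step l' l j' j hlt hc r ih =>
    exact ih.mul ((N.measurable_gate l j).comp (N.measurable_preact w l))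

lemma measurable_pathFeature (w : N.Weights) : Measurable (N.pathFeature w) :=
  (WithLp.measurable_toLp 2 _).comp <| measurable_pi_lambda _ fun p =>
    (measurable_pi_apply _).mul (N.measurable_activation w p.2.2)

end DeepNet

/-! ### Head and tail of the sample. -/

section Sample

lemma measurable_headSample {Ω Z : Type*} [MeasurableSpace Ω] [MeasurableSpace Z] {m : ℕ} (a : ℕ)
    {S : Fin m → Ω → Z} (hS : ∀ i, Measurable (S i)) : Measurable (headSample a S) :=
  measurable_pi_lambda _ fun i => hS i

lemma measurable_tailSample {Ω Z : Type*} [MeasurableSpace Ω] [MeasurableSpace Z] {m : ℕ} (a : ℕ)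
    {S : Fin m → Ω → Z} (hS : ∀ i, Measurable (S i)) : Measurable (tailSample a S) :=
  measurable_pi_lambda _ fun i => hS i

lemma card_tail (m a : ℕ) : Fintype.card {i : Fin m // a ≤ (i : ℕ)} = m - a := by
  have h : Fintype.card {i : Fin m // a ≤ (i : ℕ)} = Fintype.card (Finset.Ico a m) :=
    Fintype.card_congr
      { toFun := fun i => ⟨i.1, Finset.mem_Ico.2 ⟨i.2, i.1.isLt⟩⟩
        invFun := fun k => ⟨⟨k.1, (Finset.mem_Ico.1 k.2).2⟩, (Finset.mem_Ico.1 k.2).1⟩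
        left_inv := fun _ => rfl
        right_inv := fun _ => rfl }
  rw [h, Fintype.card_coe, Nat.card_Ico]

/-- Conditioning on an independent variable does not change the law. -/
lemma condDistrib_ae_eq_map_of_indepFun {Ω α β : Type*} [MeasurableSpace Ω] [MeasurableSpace α]
    [MeasurableSpace β] [StandardBorelSpace α] [Nonempty α] {μ : Measure Ω}
    [IsProbabilityMeasure μ] {Y : Ω → α} {X : Ω → β} (hY : Measurable Y) (hX : Measurable X)
    (h : IndepFun Y X μ) : ∀ᵐ s ∂(μ.map X), condDistrib Y X μ s = μ.map Y := by
  have := Measure.isProbabilityMeasure_map (μ := μ) hY.aemeasurable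
  have hae : condDistrib Y X μ =ᵐ[μ.map X] Kernel.const β (μ.map Y) := by
    refine condDistrib_ae_eq_of_measure_eq_compProd X hY.aemeasurable ?_
    rw [Measure.compProd_const]
    exact (indepFun_iff_map_prod_eq_prod_map_map hX.aemeasurable hY.aemeasurable).1 h.symm
  filter_upwards [hae] with s hs
  rw [hs, Kernel.const_apply]

end Sample

/-! ### Two-phase models as linear classifiers. -/

namespace DeepNet

variable (N : DeepNet)

/-- Path weights of the output units, bounded by `Cw`. -/
abbrev BoundedPathWeights (Cw : ℝ) : Type :=
  {wbar : N.Label → EuclideanSpace ℝ N.Path // ∀ k, ‖wbar k‖ ≤ Cw}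

/-- The margin loss of a two-phase model. -/
noncomputable def twoPhaseLoss (wσ : N.Weights) (ρ Cw : ℝ) (v : N.BoundedPathWeights Cw) (p : N.Example) : ℝ :=
  rampLoss ρ (classMargin (N.twoPhaseModel wσ v.1 p.1) p.2)

/-- The feature vector of the input, as a vector of path weights for output unit `k`. -/
noncomputable def labelFeature (wσ : N.Weights) (k : N.Label) (p : N.Example) :
    PiLp 2 fun _ : N.Label => EuclideanSpace ℝ N.Path :=
  PiLp.single 2 k (N.pathFeature wσ p.1)

/-- With the feature placed in block `k`, all scores are inner products with one vector, the stacked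
path weights, as the abstract bound requires. -/
lemma inner_labelFeature (wσ : N.Weights) (wbar : N.Label → EuclideanSpace ℝ N.Path)
    (k : N.Label) (p : N.Example) :
    ⟪(WithLp.toLp 2 wbar : PiLp 2 fun _ : N.Label => EuclideanSpace ℝ N.Path),
      N.labelFeature wσ k p⟫_ℝ = N.twoPhaseModel wσ wbar p.1 k := by
  rw [PiLp.inner_apply, Finset.sum_eq_single k]
  · simp [labelFeature, twoPhaseModel, real_inner_comm]
  · intro j _ hj
    simp [labelFeature, hj]
  · simp

lemma norm_labelFeature (wσ : N.Weights) (k : N.Label) (p : N.Example) :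
    ‖N.labelFeature wσ k p‖ = ‖N.pathFeature wσ p.1‖ :=
  PiLp.norm_single 2 _ k _

lemma stronglyMeasurable_labelFeature (wσ : N.Weights) (k : N.Label) :
    StronglyMeasurable (N.labelFeature wσ k) := by
  have hc : Continuous fun y : EuclideanSpace ℝ N.Path =>
      (PiLp.single 2 k y : PiLp 2 fun _ : N.Label => EuclideanSpace ℝ N.Path) :=
    (PiLp.continuous_toLp 2 _).comp (continuous_single (A := fun _ : N.Label => EuclideanSpace ℝ N.Path) k)
  exact hc.comp_stronglyMeasurable
    ((N.measurable_pathFeature wσ).comp measurable_fst).stronglyMeasurable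

lemma norm_toLp_pathWeights_le {Cw : ℝ} (hCw : 0 ≤ Cw)
    {wbar : N.Label → EuclideanSpace ℝ N.Path} (hw : ∀ k, ‖wbar k‖ ≤ Cw) :
    ‖(WithLp.toLp 2 wbar : PiLp 2 fun _ : N.Label => EuclideanSpace ℝ N.Path)‖
      ≤ √(Fintype.card N.Label) * Cw := by
  rw [PiLp.norm_eq_of_L2, ← Real.sqrt_sq hCw, ← Real.sqrt_mul (by positivity)]
  refine Real.sqrt_le_sqrt ?_
  refine (Finset.sum_le_card_nsmul _ _ (Cw ^ 2) fun k _ => ?_).trans_eq (by simp)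
  exact pow_le_pow_left₀ (norm_nonneg _) (hw k) 2

variable [Nontrivial N.Label]

lemma measurable_twoPhaseLoss (wσ : N.Weights) {ρ : ℝ} (hρ : 0 < ρ) (Cw : ℝ)
    (v : N.BoundedPathWeights Cw) : Measurable (N.twoPhaseLoss wσ ρ Cw v) := by
  refine (measurable_rampLoss_classMargin hρ).comp (Measurable.prodMk ?_ measurable_snd)
  refine measurable_pi_lambda _ fun k => ?_
  exact ((N.measurable_pathFeature wσ).comp measurable_fst).inner measurable_const

lemma continuous_twoPhaseLoss (wσ : N.Weights) {ρ : ℝ} (hρ : 0 < ρ) (Cw : ℝ) (p : N.Example) :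
    Continuous fun v => N.twoPhaseLoss wσ ρ Cw v p := by
  refine (continuous_rampLoss_classMargin hρ p.2).comp (continuous_pi fun k => ?_)
  exact continuous_const.inner ((continuous_apply k).comp continuous_subtype_val)

lemma zeroOneRisk_twoPhaseModel_le (P : Measure N.Example) [IsProbabilityMeasure P]
    (wσ : N.Weights) {ρ : ℝ} (hρ : 0 < ρ) {Cw : ℝ} (v : N.BoundedPathWeights Cw) :
    zeroOneRisk P (N.twoPhaseModel wσ v.1) ≤ ∫ p, N.twoPhaseLoss wσ ρ Cw v p ∂P := by
  -- Only the dominating ramp loss has to be integrable; measurability of the 0-1 loss is not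
  -- needed.
  refine integral_mono_of_nonneg (Filter.Eventually.of_forall fun p => zeroOneLoss_nonneg _ _) ?_
    (Filter.Eventually.of_forall fun p => zeroOneLoss_le_rampLoss hρ _ _)
  exact Integrable.of_mem_Icc 0 1 (N.measurable_twoPhaseLoss wσ hρ Cw v).aemeasurable
    (Filter.Eventually.of_forall fun p => rampLoss_mem_Icc hρ _)

/-- The margin bound for two-phase models holds with probability at least `1 - δ`. -/
theorem le_measure_uniformGood_twoPhaseLoss (P : Measure N.Example) [IsProbabilityMeasure P]
    {ι : Type*} [Fintype ι] [Nonempty ι] (wσ : N.Weights) {ρ : ℝ} (hρ : 0 < ρ) {Cσ Cw : ℝ}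
    (hCσ : 0 ≤ Cσ) (hCw : 0 ≤ Cw) {δ : ℝ} (hδ : 0 < δ)
    (hint : Integrable (fun p : N.Example => ‖N.pathFeature wσ p.1‖ ^ 2) P)
    (hle : ∫ p : N.Example, ‖N.pathFeature wσ p.1‖ ^ 2 ∂P ≤ Cσ ^ 2) {r : ℝ}
    (hr : 2 * (Fintype.card N.Label : ℝ) ^ 2 * Cσ * Cw / (ρ * √(Fintype.card ι))
      + √(Real.log (1 / δ) / (2 * Fintype.card ι)) ≤ r) :
    ENNReal.ofReal (1 - δ)
      ≤ (Measure.pi fun _ : ι => P) (uniformGood P ι (N.twoPhaseLoss wσ ρ Cw) r) := by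
  rcases lt_or_ge 1 δ with hδ1 | hδ1
  · rw [ENNReal.ofReal_of_nonpos (by linarith)]; exact zero_le
  have : Nonempty (N.BoundedPathWeights Cw) := ⟨⟨0, fun k => by simpa using hCw⟩⟩
  have hmem : ∀ k, MemLp (N.labelFeature wσ k) 2 P := fun k => by
    rw [memLp_two_iff_integrable_sq_norm (N.stronglyMeasurable_labelFeature wσ k).aestronglyMeasurable]
    simpa only [norm_labelFeature] using hint
  refine le_measure_uniformGood P (u := fun v : N.BoundedPathWeights Cw => WithLp.toLp 2 v.1)
    (fun v => N.norm_toLp_pathWeights_le hCw v.2) (N.measurable_twoPhaseLoss wσ hρ Cw)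
    (fun v p => rampLoss_mem_Icc hρ _) (N.continuous_twoPhaseLoss wσ hρ Cw)
    (N.stronglyMeasurable_labelFeature wσ) hmem (L := 1 / ρ) (σ := Cσ) (by positivity) hCσ
    (fun v v' p => ?_) (fun k => ?_) hδ hδ1 (le_trans ?_ hr)
  · simp only [inner_labelFeature]
    exact abs_rampLoss_classMargin_sub_le hρ _ _ _
  · simpa only [norm_labelFeature] using hle
  · have hd : (1 : ℝ) ≤ Fintype.card N.Label := by
      exact_mod_cast Fintype.card_pos
    have hn : (0 : ℝ) < √(Fintype.card ι) := Real.sqrt_pos.2 (by exact_mod_cast Fintype.card_pos)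
    set d : ℝ := (Fintype.card N.Label : ℝ)
    -- Stacking the weights costs `√d` in the norm; rounding it up to `d` gives the squared number
    -- of labels.
    have hsq : √d ≤ d := by
      rw [Real.sqrt_le_left (by linarith)]
      nlinarith
    gcongr ?_ + _
    calc √d * Cw * (2 * (1 / ρ) * d * Cσ) / √(Fintype.card ι)
        ≤ d * Cw * (2 * (1 / ρ) * d * Cσ) / √(Fintype.card ι) := by gcongr
      _ = _ := by field_simp

end DeepNet

/-! ### The generalization bound. -/

theorem mainTheorem3 (N : DeepNet) [Nontrivial N.Label]
    {Ω : Type*} [MeasurableSpace Ω] (μ : Measure Ω) [IsProbabilityMeasure μ]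
    (P : Measure N.Example) [IsProbabilityMeasure P]
    (m a : ℕ) (hm : 0 < m) (α : ℝ) (hα0 : 0 < α) (hα1 : α < 1) (ha : (a : ℝ) = α * m)
    (S : Fin m → Ω → N.Example) (hS : ∀ i, Measurable (S i))
    (hlaw : ∀ i : Fin m, a ≤ (i : ℕ) → μ.map (S i) = P)
    (hiid : iIndepFun (fun i : {i : Fin m // a ≤ (i : ℕ)} => S i) μ)
    (hindep : IndepFun (tailSample a S) (headSample a S) μ)
    (mσ : ℝ) (hmσ : mσ = (1 - α) * m)
    (ρ : ℝ) (hρ : 0 < ρ) (Cσ Cw : ℝ) (hCσ : 0 ≤ Cσ) (δ : ℝ) (hδ : 0 < δ) :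
    ∃ good : N.Weights → Set ({i : Fin m // a ≤ (i : ℕ)} → N.Example),
      (∀ wσ : N.Weights,
        Integrable (fun p : N.Example => ‖N.pathFeature wσ p.1‖ ^ 2) P →
        ∫ p : N.Example, ‖N.pathFeature wσ p.1‖ ^ 2 ∂P ≤ Cσ ^ 2 →
        MeasurableSet (good wσ) ∧
        (∀ t ∈ good wσ, ∀ f ∈ N.twoPhaseClass wσ Cw,
          zeroOneRisk P f ≤ empiricalMarginLoss ρ t f
            + 2 * (Fintype.card N.Label : ℝ) ^ 2 * (1 - α) ^ (-(1 / 2) : ℝ) * Cσ * Cw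
                / (ρ * √mσ)
            + √(Real.log (1 / δ) / (2 * mσ))) ∧
        ENNReal.ofReal (1 - δ) ≤ μ {ω | tailSample a S ω ∈ good wσ}) ∧
      (∀ᵐ s ∂(μ.map (headSample a S)), ∀ wσ : N.Weights,
        Integrable (fun p : N.Example => ‖N.pathFeature wσ p.1‖ ^ 2) P →
        ∫ p : N.Example, ‖N.pathFeature wσ p.1‖ ^ 2 ∂P ≤ Cσ ^ 2 →
        ENNReal.ofReal (1 - δ) ≤ condDistrib (tailSample a S) (headSample a S) μ s (good wσ)) := by
  have hm' : (0 : ℝ) < m := by exact_mod_cast hm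
  have ham : a < m := by
    have : (a : ℝ) < m := by rw [ha]; nlinarith
    exact_mod_cast this
  have hcard : (Fintype.card {i : Fin m // a ≤ (i : ℕ)} : ℝ) = mσ := by
    rw [card_tail, Nat.cast_sub ham.le, hmσ, ha]; ring
  have : Nonempty {i : Fin m // a ≤ (i : ℕ)} := ⟨⟨⟨a, ham⟩, le_rfl⟩⟩
  have htail := measurable_tailSample a hS
  have hpi : μ.map (tailSample a S) = Measure.pi fun _ => P := by
    have h := (iIndepFun_iff_map_fun_eq_pi_map fun i : {i : Fin m // a ≤ (i : ℕ)} =>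
      (hS i).aemeasurable).1 hiid
    refine h.trans ?_
    congr 1
    ext1 i
    exact hlaw i i.2
  set r : ℝ := 2 * (Fintype.card N.Label : ℝ) ^ 2 * (1 - α) ^ (-(1 / 2) : ℝ) * Cσ * Cw / (ρ * √mσ)
    + √(Real.log (1 / δ) / (2 * mσ)) with hr
  -- For negative `Cw` the class is empty and every sample is good.
  rcases lt_or_ge Cw 0 with hCw | hCw
  · refine ⟨fun _ => Set.univ, fun wσ _ _ => ⟨MeasurableSet.univ, ?_, ?_⟩, ?_⟩
    · rintro t - f ⟨wbar, hw, -⟩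
      exact absurd ((norm_nonneg _).trans (hw (Classical.arbitrary _))) (not_le.2 hCw)
    · simpa using hδ.le
    · exact Filter.Eventually.of_forall fun s wσ _ _ => by simpa using hδ.le
  have hrate : 2 * (Fintype.card N.Label : ℝ) ^ 2 * Cσ * Cw
        / (ρ * √(Fintype.card {i : Fin m // a ≤ (i : ℕ)}))
      + √(Real.log (1 / δ) / (2 * Fintype.card {i : Fin m // a ≤ (i : ℕ)})) ≤ r := by
    rw [hcard, hr]
    -- The factor `(1 - α) ^ (-1/2)` is slack: the bound holds without it.
    have : (1 : ℝ) ≤ (1 - α) ^ (-(1 / 2) : ℝ) :=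
      Real.one_le_rpow_of_pos_of_le_one_of_nonpos (by linarith) (by linarith) (by norm_num)
    gcongr ?_ / _ + _
    calc 2 * (Fintype.card N.Label : ℝ) ^ 2 * Cσ * Cw
        = 2 * (Fintype.card N.Label : ℝ) ^ 2 * 1 * Cσ * Cw := by ring
      _ ≤ _ := by gcongr
  have hprob : ∀ wσ : N.Weights,
      Integrable (fun p : N.Example => ‖N.pathFeature wσ p.1‖ ^ 2) P →
      ∫ p : N.Example, ‖N.pathFeature wσ p.1‖ ^ 2 ∂P ≤ Cσ ^ 2 →
      ENNReal.ofReal (1 - δ) ≤ μ.map (tailSample a S) (uniformGood P _ (N.twoPhaseLoss wσ ρ Cw) r) :=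
    fun wσ hint hle => by
      rw [hpi]
      exact N.le_measure_uniformGood_twoPhaseLoss P wσ hρ hCσ hCw hδ hint hle hrate
  have : Nonempty (N.BoundedPathWeights Cw) := ⟨⟨0, fun k => by simpa using hCw⟩⟩
  have hmeas : ∀ wσ, MeasurableSet
      (uniformGood P {i : Fin m // a ≤ (i : ℕ)} (N.twoPhaseLoss wσ ρ Cw) r) := fun wσ =>
    measurableSet_uniformGood P (N.measurable_twoPhaseLoss wσ hρ Cw)
      (fun v p => rampLoss_mem_Icc hρ _) (N.continuous_twoPhaseLoss wσ hρ Cw) r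
  refine ⟨fun wσ => uniformGood P _ (N.twoPhaseLoss wσ ρ Cw) r, fun wσ hint hle =>
    ⟨hmeas wσ, ?_, ?_⟩, ?_⟩
  · rintro t ht f ⟨wbar, hw, rfl⟩
    rw [add_assoc]
    exact (N.zeroOneRisk_twoPhaseModel_le P wσ hρ ⟨wbar, hw⟩).trans (ht ⟨wbar, hw⟩)
  · have h := hprob wσ hint hle
    rwa [Measure.map_apply htail (hmeas wσ)] at h
  -- The exceptional null set is where the conditional law differs from the law of the tail. It does
  -- not depend on `wσ`, so all `wσ` are covered at once.
  · filter_upwards [condDistrib_ae_eq_map_of_indepFun htail (measurable_headSample a hS) hindep]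
      with s hs wσ hint hle
    rw [hs]
    exact hprob wσ hint hle
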